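/- Let $n\ge 1$, let $\mu_\infty$ be the group of roots of unity in $\overline{\mathbb{Q}}$, and let $\zeta=(\zeta_1,\dots,\zeta_n)\in\mu_\infty^n$ be a point of order $m$ in the group $\mu_\infty^n$. For $\lambda\in\mathbb{Z}^n$ write $\zeta^\lambda=\zeta_1^{\lambda_1}\cdots\zeta_n^{\lambda_n}$. Let $$F(X)=\sum_{i=1}^N a_iX^{\alpha_i}\in\mathbb{Z}[X_1^{\pm1},\dots,X_n^{\pm1}],\qquad a_i\in\mathbb{Z},\ \alpha_i\in\mathbb{Z}^n,$$ be a Laurent polynomial. Suppose that 1. $F(\zeta)=0$; 2. no proper subsum of $F(\zeta)$ vanishes, i.e. $\sum_{i\in J}a_i\zeta^{\alpha_i}\neq 0$ for every nonempty proper subset $J$ of $\{1,\dots,N\}$; 3. the differences $\alpha_i-\alpha_j$ $(1\le i,j\le N)$ generate the group $\mathbb{Z}^n$. Then $m$ is squarefree and $\Psi(m)\le N$, where $\Psi(m):=2+\sum_{p\mid m}(p-2)$, the sum running over the prime numbers $p$ dividing $m$. -/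

import Mathlib

noncomputable section

/-- The field of algebraic numbers. -/
abbrev QBar : Type := AlgebraicClosure ℚ

/-- The group of all roots of unity in the field of algebraic numbers. -/
abbrev MuInf : Subgroup QBarˣ := CommGroup.torsion QBarˣ

/-- Laurent polynomials with integer coefficients in `n` variables: finite formal combinations of
the monomials `X ^ l = ∏ i, X i ^ l i`, for exponent vectors `l` with integer entries. -/
abbrev MvLaurent (n : ℕ) : Type := AddMonoidAlgebra ℤ (Fin n → ℤ)

/-- The value `z ^ l = ∏ i, z i ^ l i` of the monomial with exponent vector `l` at the point `z`
of the torus. -/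
def torusMonomial {n : ℕ} (z : Fin n → QBarˣ) (l : Fin n → ℤ) : QBar :=
  ((∏ i, z i ^ l i : QBarˣ) : QBar)

/-- The value `F(z)` of a Laurent polynomial at a point of the torus. -/
def MvLaurent.eval {n : ℕ} (z : Fin n → QBarˣ) (F : MvLaurent n) : QBar :=
  F.coeff.sum fun l a => (a : QBar) * torusMonomial z l

/-- No proper subsum of `∑ i, v i` vanishes; the proper subsums are those over the nonempty
proper subsets of the index set. -/
def NoProperSubsumVanishes {ι : Type*} [Fintype ι] (v : ι → QBar) : Prop :=
  ∀ J : Finset ι, J.Nonempty → J ≠ Finset.univ → ∑ i ∈ J, v i ≠ 0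

/-- `Ψ(m) = 2 + ∑_{p ∣ m} (p - 2)`, where `p` runs over the prime divisors of `m`. -/
def conwayJonesPsi (m : ℕ) : ℤ :=
  2 + ∑ p ∈ m.primeFactors, ((p : ℤ) - 2)

end

/-! Divide the vanishing sum by one monomial: its terms become rational multiples of roots of unity
`η i`, one of them 1, whose orders have least common multiple m because the exponent differences
generate ℤⁿ. Minimality makes `η` span-connected, since any proper subsum is nonzero and lies in
both complementary spans. The relation itself makes dim span(η) < N, so it suffices to show that m
is squarefree and 1 + ∑ (p - 2) ≤ dim span(η). For a prime p dividing m, write `η i = ρ ^ e i * θ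
i`, with `θ i` in the field generated by the roots of unity of order m/p. If p² ∣ m, take ρ of order
m: its powers below p are independent over that field, connectedness forces every `e i` to vanish,
and the order drops. If p ∥ m, take ρ of order p: the only relation among its powers is that their
sum is zero. Then `θ` is again connected, and passing from `η` to `θ` loses at least p - 2
dimensions; induct on m. Connectedness, unlike a minimal relation, is what this descent preserves.
-/

open Module

/-! ### Linear algebra of span-connected families graded by powers of ρ -/

section Decomposition

variable {ι L : Type*} [Field L] [Algebra ℚ L]

/-- A family of vectors is span-connected if its span never splits as the direct sum of the spans
of two complementary nonempty subfamilies. -/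
def SpanConnected (v : ι → L) : Prop :=
  ∀ J : Set ι, J.Nonempty → Jᶜ.Nonempty →
    ∃ x, x ≠ 0 ∧ x ∈ Submodule.span ℚ (v '' J) ∧ x ∈ Submodule.span ℚ (v '' Jᶜ)

theorem exists_graded_of_mem_span {p : ℕ} (ρ : L) (e : ι → Fin p) (θ : ι → L) (J : Set ι) {x : L}
    (hx : x ∈ Submodule.span ℚ ((fun i => ρ ^ (e i : ℕ) * θ i) '' J)) :
    ∃ y : Fin p → L, (∀ j, y j ∈ Submodule.span ℚ (θ '' (J ∩ e ⁻¹' {j}))) ∧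
      x = ∑ j : Fin p, ρ ^ (j : ℕ) * y j := by
  induction hx using Submodule.span_induction with
  | mem x hx =>
    obtain ⟨i, hi, rfl⟩ := hx
    refine ⟨fun j => if j = e i then θ i else 0, fun j => ?_, by simp⟩
    by_cases hj : j = e i
    · simpa [hj] using Submodule.subset_span (R := ℚ)
        (Set.mem_image_of_mem θ (show i ∈ J ∩ e ⁻¹' {e i} from ⟨hi, rfl⟩))
    · simp [hj]
  | zero => exact ⟨0, by simp, by simp⟩
  | add x y _ _ hx hy =>
    obtain ⟨x', hx', rfl⟩ := hx
    obtain ⟨y', hy', rfl⟩ := hy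
    exact ⟨x' + y', fun j => add_mem (hx' j) (hy' j), by simp [mul_add, Finset.sum_add_distrib]⟩
  | smul c x _ hx =>
    obtain ⟨x', hx', rfl⟩ := hx
    exact ⟨c • x', fun j => Submodule.smul_mem _ _ (hx' j), by
      simp only [Pi.smul_apply, mul_smul_comm]
      exact map_sum (LinearMap.lsmul ℚ L c) _ _⟩

/-- Each further subspace meets the previous sum in at least the line through `x`, so it costs at
least one dimension. -/
theorem finrank_finset_sup_add_card_le {κ V : Type*} [AddCommGroup V] [Module ℚ V]
    (W : κ → Submodule ℚ V) [∀ j, FiniteDimensional ℚ (W j)] (j₀ : κ) {x : V} (hx : x ≠ 0)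
    (hxW : ∀ j, x ∈ W j) (s : Finset κ) :
    finrank ℚ (W j₀ ⊔ s.sup W : Submodule ℚ V) + s.card
      ≤ finrank ℚ (W j₀) + ∑ j ∈ s, finrank ℚ (W j) := by
  classical
  induction s using Finset.induction_on with
  | empty => rw [Finset.sup_empty, sup_bot_eq]; simp
  | insert j s hj ih =>
    have hfin : FiniteDimensional ℚ (s.sup W : Submodule ℚ V) :=
      Submodule.finiteDimensional_finset_sup s W
    have h := Submodule.finrank_sup_add_finrank_inf_eq (W j₀ ⊔ s.sup W) (W j)
    have hpos : 0 < finrank ℚ ((W j₀ ⊔ s.sup W) ⊓ W j : Submodule ℚ V) := by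
      have : Nontrivial ((W j₀ ⊔ s.sup W) ⊓ W j : Submodule ℚ V) :=
        ⟨⟨⟨x, ⟨Submodule.mem_sup_left (hxW j₀), hxW j⟩⟩, 0, fun h => hx (congrArg Subtype.val h)⟩⟩
      have : FiniteDimensional ℚ ((W j₀ ⊔ s.sup W) ⊓ W j : Submodule ℚ V) :=
        Submodule.finiteDimensional_inf_right _ _
      exact finrank_pos
    rw [Finset.sum_insert hj, Finset.card_insert_of_notMem hj, Finset.sup_insert,
      sup_comm (W j), ← sup_assoc]
    omega

/-- Two subspaces `a` and `b` are set aside: `a` starts the sum, and `b` is added last, where the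
overlap contains the whole intersection instead of just a line. The remaining card - 2 subspaces
lose one dimension each. -/
theorem finrank_iSup_add_finrank_iInf_le {κ V : Type*} [Fintype κ] [Nontrivial κ]
    [AddCommGroup V] [Module ℚ V]
    (W : κ → Submodule ℚ V) [∀ j, FiniteDimensional ℚ (W j)] {x : V} (hx : x ≠ 0)
    (hxW : ∀ j, x ∈ W j) :
    finrank ℚ (⨆ j, W j : Submodule ℚ V) + finrank ℚ (⨅ j, W j : Submodule ℚ V)
      + Fintype.card κ ≤ ∑ j, finrank ℚ (W j) + 2 := by
  classical
  obtain ⟨a, b, hab⟩ := exists_pair_ne κ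
  set s : Finset κ := (Finset.univ.erase a).erase b with hs
  have ha : insert a (insert b s) = Finset.univ := by
    rw [hs, Finset.insert_erase (by simp [hab.symm]), Finset.insert_erase (by simp)]
  have hb : b ∉ s := by simp [hs]
  have ha' : a ∉ insert b s := by simp [hs, hab]
  have hfin : FiniteDimensional ℚ (s.sup W : Submodule ℚ V) :=
    Submodule.finiteDimensional_finset_sup s W
  have h := Submodule.finrank_sup_add_finrank_inf_eq (W a ⊔ s.sup W) (W b)
  have h' := finrank_finset_sup_add_card_le W a hx hxW s
  have : FiniteDimensional ℚ ((W a ⊔ s.sup W) ⊓ W b : Submodule ℚ V) :=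
    Submodule.finiteDimensional_inf_right _ _
  have hinf : finrank ℚ (⨅ j, W j : Submodule ℚ V)
      ≤ finrank ℚ ((W a ⊔ s.sup W) ⊓ W b : Submodule ℚ V) :=
    Submodule.finrank_mono (le_inf (le_sup_of_le_left (iInf_le _ a)) (iInf_le _ b))
  have hsup : (⨆ j, W j) = W a ⊔ s.sup W ⊔ W b := by
    rw [← Finset.sup_univ_eq_iSup, ← ha, Finset.sup_insert, Finset.sup_insert,
      sup_comm (W b), sup_assoc]
  rw [hsup, ← Finset.card_univ, ← ha, Finset.sum_insert ha', Finset.sum_insert hb,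
    Finset.card_insert_of_notMem ha', Finset.card_insert_of_notMem hb]
  omega

variable {p : ℕ} {ρ : L} {F : Submodule ℚ L} {e : ι → Fin p} {θ : ι → L}

/-- If the `θ`-spans of J and its complement met trivially, take a common vector ∑ ρ^j y_j = ∑ ρ^j
z_j of the original spans. By `hind`, y_j - z_j is constant in j, so y_j - y_0 = z_j - z_0 lies in
both `θ`-spans and vanishes. Then y is constant and the common vector is y_0 ∑ ρ^j = 0. -/
theorem SpanConnected.of_graded (hρ : ∑ j : Fin p, ρ ^ (j : ℕ) = 0)
    (hind : ∀ y : Fin p → L, (∀ j, y j ∈ F) → ∑ j : Fin p, ρ ^ (j : ℕ) * y j = 0 → ∀ i j, y i = y j)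
    (hθ : ∀ i, θ i ∈ F) (hp : 0 < p)
    (hconn : SpanConnected fun i => ρ ^ (e i : ℕ) * θ i) : SpanConnected θ := by
  intro J hJ hJ'
  by_contra! hcon
  obtain ⟨x, hx0, hx, hx'⟩ := hconn J hJ hJ'
  obtain ⟨y, hy, rfl⟩ := exists_graded_of_mem_span ρ e θ J hx
  obtain ⟨z, hz, hyz⟩ := exists_graded_of_mem_span ρ e θ Jᶜ hx'
  have hF : ∀ S : Set ι, Submodule.span ℚ (θ '' S) ≤ F := fun S =>
    Submodule.span_le.2 (by rintro _ ⟨i, -, rfl⟩; exact hθ i)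
  have hd := hind (fun j => y j - z j) (fun j => sub_mem (hF _ (hy j)) (hF _ (hz j)))
    (by simp only [mul_sub, Finset.sum_sub_distrib, hyz, sub_self])
  have hyJ : ∀ j, y j ∈ Submodule.span ℚ (θ '' J) := fun j =>
    Submodule.span_mono (Set.image_mono Set.inter_subset_left) (hy j)
  have hzJ : ∀ j, z j ∈ Submodule.span ℚ (θ '' Jᶜ) := fun j =>
    Submodule.span_mono (Set.image_mono Set.inter_subset_left) (hz j)
  have hconst : ∀ j, y j = y ⟨0, hp⟩ := by
    intro j
    by_contra hne
    refine hcon (y j - y ⟨0, hp⟩) (sub_ne_zero.2 hne) (sub_mem (hyJ _) (hyJ _)) ?_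
    have : y j - y ⟨0, hp⟩ = z j - z ⟨0, hp⟩ := by linear_combination hd j ⟨0, hp⟩
    rw [this]
    exact sub_mem (hzJ _) (hzJ _)
  apply hx0
  simp_rw [hconst, ← Finset.sum_mul, hρ, zero_mul]

/-- Split off one class of `e`. A vector common to the two spans has one expansion y supported on
that class and another, z, vanishing there; constancy of y - z puts the single coefficient of y in
the span of every class. -/
theorem SpanConnected.exists_mem_of_graded
    (hind : ∀ y : Fin p → L, (∀ j, y j ∈ F) → ∑ j : Fin p, ρ ^ (j : ℕ) * y j = 0 → ∀ i j, y i = y j)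
    (hθ : ∀ i, θ i ∈ F) (hne : ∃ i j, e i ≠ e j)
    (hconn : SpanConnected fun i => ρ ^ (e i : ℕ) * θ i) :
    ∃ x, x ≠ 0 ∧ ∀ j, x ∈ Submodule.span ℚ (θ '' (e ⁻¹' {j})) := by
  obtain ⟨a, b, hab⟩ := hne
  obtain ⟨x, hx0, hx, hx'⟩ := hconn (e ⁻¹' {e a}) ⟨a, rfl⟩ ⟨b, fun h => hab h.symm⟩
  obtain ⟨y, hy, rfl⟩ := exists_graded_of_mem_span ρ e θ _ hx
  obtain ⟨z, hz, hyz⟩ := exists_graded_of_mem_span ρ e θ _ hx'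
  have hF : ∀ S : Set ι, Submodule.span ℚ (θ '' S) ≤ F := fun S =>
    Submodule.span_le.2 (by rintro _ ⟨i, -, rfl⟩; exact hθ i)
  have hd := hind (fun j => y j - z j) (fun j => sub_mem (hF _ (hy j)) (hF _ (hz j)))
    (by simp only [mul_sub, Finset.sum_sub_distrib, hyz, sub_self])
  have hy0 : ∀ j, j ≠ e a → y j = 0 := by
    intro j hj
    have h := hy j
    rwa [← Set.preimage_inter, Set.singleton_inter_eq_empty.2 (by simpa using hj.symm),
      Set.preimage_empty, Set.image_empty, Submodule.span_empty, Submodule.mem_bot] at h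
  have hz0 : z (e a) = 0 := by
    simpa using hz (e a)
  have hya : ∀ j, j ≠ e a → y (e a) = - z j := by
    intro j hj
    have := hd (e a) j
    simp only [hz0, hy0 j hj] at this
    linear_combination this
  refine ⟨y (e a), fun h0 => hx0 (Finset.sum_eq_zero fun j _ => ?_), fun j => ?_⟩
  · by_cases hj : j = e a
    · rw [hj, h0, mul_zero]
    · rw [hy0 j hj, mul_zero]
  · by_cases hj : j = e a
    · simpa [hj] using hy (e a)
    · rw [hya j hj]
      exact neg_mem (Submodule.span_mono (Set.image_mono Set.inter_subset_right) (hz j))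

theorem SpanConnected.finrank_add_le_of_graded [Finite ι] (hp : 2 ≤ p)
    (hind : ∀ y : Fin p → L, (∀ j, y j ∈ F) → ∑ j : Fin p, ρ ^ (j : ℕ) * y j = 0 → ∀ i j, y i = y j)
    (hθ : ∀ i, θ i ∈ F) (hne : ∃ i j, e i ≠ e j)
    (hconn : SpanConnected fun i => ρ ^ (e i : ℕ) * θ i) :
    finrank ℚ (Submodule.span ℚ (Set.range θ)) + p
      ≤ finrank ℚ (Submodule.span ℚ (Set.range fun i => ρ ^ (e i : ℕ) * θ i)) + 2 := by
  obtain ⟨x, hx0, hx⟩ := hconn.exists_mem_of_graded hind hθ hne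
  set W : Fin p → Submodule ℚ L := fun j => Submodule.span ℚ (θ '' (e ⁻¹' {j})) with hW
  have hWfin : ∀ j, FiniteDimensional ℚ (W j) := fun j =>
    FiniteDimensional.span_of_finite ℚ (Set.toFinite _)
  have hWF : ∀ j, W j ≤ F := fun j =>
    Submodule.span_le.2 (by rintro _ ⟨i, -, rfl⟩; exact hθ i)
  have : Nontrivial (Fin p) := Fin.nontrivial_iff_two_le.2 hp
  have hle := finrank_iSup_add_finrank_iInf_le W hx0 hx
  have hsup : Submodule.span ℚ (Set.range θ) = ⨆ j, W j := by
    rw [hW, ← Submodule.span_iUnion, ← Set.image_iUnion, ← Set.preimage_iUnion,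
      Set.iUnion_of_singleton, Set.preimage_univ, Set.image_univ]
  -- `T` has image in the span of the original family, and by `hind` its kernel consists of constant
  -- tuples, hence embeds in ⨅ W j. So that span has dimension at least ∑ dim W j - dim ⨅ W j, and
  -- the intersection term cancels against the one in `hle`.
  let T : (∀ j, W j) →ₗ[ℚ] L :=
    ∑ j : Fin p, (LinearMap.mulLeft ℚ (ρ ^ (j : ℕ))) ∘ₗ (W j).subtype ∘ₗ LinearMap.proj j
  have hT : ∀ y, T y = ∑ j : Fin p, ρ ^ (j : ℕ) * (y j : L) := fun y => by simp [T]
  have hrange : LinearMap.range T ≤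
      Submodule.span ℚ (Set.range fun i => ρ ^ (e i : ℕ) * θ i) := by
    rintro _ ⟨y, rfl⟩
    rw [hT]
    refine Submodule.sum_mem _ fun j _ => ?_
    have h1 : ρ ^ (j : ℕ) * (y j : L) ∈
        (Submodule.span ℚ (θ '' (e ⁻¹' {j}))).map (LinearMap.mulLeft ℚ (ρ ^ (j : ℕ))) :=
      Submodule.mem_map_of_mem (y j).2
    rw [Submodule.map_span] at h1
    refine Submodule.span_mono ?_ h1
    rintro _ ⟨_, ⟨i, hi, rfl⟩, rfl⟩
    exact ⟨i, by simp [show e i = j from hi]⟩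
  have hker : finrank ℚ (LinearMap.ker T) ≤ finrank ℚ (⨅ j, W j : Submodule ℚ L) := by
    let j₀ : Fin p := ⟨0, by omega⟩
    have hconst : ∀ y ∈ LinearMap.ker T, ∀ i j, (y i : L) = y j := fun y hy =>
      hind (fun j => (y j : L)) (fun j => hWF j (y j).2) (by rw [← hT]; exact hy)
    let f : LinearMap.ker T →ₗ[ℚ] (⨅ j, W j : Submodule ℚ L) :=
      LinearMap.codRestrict _ ((W j₀).subtype ∘ₗ LinearMap.proj j₀ ∘ₗ (LinearMap.ker T).subtype)
        (fun y => (Submodule.mem_iInf _).2 fun j => by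
          have := hconst y y.2 j₀ j
          simp only [LinearMap.comp_apply, Submodule.subtype_apply, LinearMap.proj_apply]
          rw [this]
          exact (y.1 j).2)
    have : FiniteDimensional ℚ (⨅ j, W j : Submodule ℚ L) :=
      Submodule.finiteDimensional_of_le (iInf_le W j₀)
    refine LinearMap.finrank_le_finrank_of_injective (f := f) fun y z hyz => ?_
    have h0 : ((y : ∀ j, W j) j₀ : L) = (z : ∀ j, W j) j₀ := 
      congrArg (fun w : (⨅ j, W j : Submodule ℚ L) => (w : L)) hyz
    ext j
    rw [hconst y y.2 j j₀, h0, hconst z z.2 j₀ j]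
  have hrn := LinearMap.finrank_range_add_finrank_ker T
  rw [Module.finrank_pi_fintype] at hrn
  have : FiniteDimensional ℚ (Submodule.span ℚ (Set.range fun i => ρ ^ (e i : ℕ) * θ i)) :=
    FiniteDimensional.span_of_finite ℚ (Set.finite_range _)
  have hmono := Submodule.finrank_mono hrange
  rw [hsup]
  rw [Fintype.card_fin] at hle
  omega

end Decomposition

/-! ### Relations between roots of unity over cyclotomic fields -/

section Cyclotomic
open IntermediateField Polynomial
-- Tower law. It is applied to a root of unity of order p * m, with k = 1 when p ∣ m and k = m when
-- p and m are coprime.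
theorem finrank_adjoin_pow_mul_natDegree_minpoly {K L : Type*} [Field K] [Field L] [Algebra K L]
    {ω : L} (hω : IsIntegral K ω) (p k : ℕ) (hgen : ω ∈ K⟮ω ^ p, ω ^ k⟯) :
    finrank K K⟮ω ^ p⟯ * (minpoly K⟮ω ^ p⟯ (ω ^ k)).natDegree = finrank K K⟮ω⟯ := by
  rw [← adjoin.finrank (hω.pow k).tower_top]
  have h : (adjoin K⟮ω ^ p⟯ {ω ^ k}).restrictScalars K = K⟮ω⟯ := by
    rw [adjoin_adjoin_left]
    apply le_antisymm
    · rw [adjoin_le_iff, Set.union_subset_iff, Set.singleton_subset_iff, Set.singleton_subset_iff]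
      exact ⟨pow_mem (mem_adjoin_simple_self K ω) p, pow_mem (mem_adjoin_simple_self K ω) k⟩
    · rwa [adjoin_simple_le_iff]
  exact (finrank_mul_finrank K K⟮ω ^ p⟯ (adjoin K⟮ω ^ p⟯ {ω ^ k})).trans
    (congrArg (fun E : IntermediateField K L => finrank K E) h)

theorem IsPrimitiveRoot.sum_pow_fin_eq_zero {L : Type*} [Field L] {p : ℕ} (hp : p.Prime) {ρ : L}
    (hρ : IsPrimitiveRoot ρ p) : ∑ j : Fin p, ρ ^ (j : ℕ) = 0 := by
  rw [Fin.sum_univ_eq_sum_range (fun j => ρ ^ j)]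
  exact hρ.geom_sum_eq_zero hp.one_lt

variable {L : Type*} [Field L] [Algebra ℚ L]

theorem IsPrimitiveRoot.finrank_rat_adjoin {m : ℕ} {ω : L} (hω : IsPrimitiveRoot ω m)
    (hm : 0 < m) : finrank ℚ ℚ⟮ω⟯ = m.totient := by
  have : NeZero (m : ℚ) := ⟨by exact_mod_cast hm.ne'⟩
  have hint : IsIntegral ℚ ω := (hω.isIntegral hm).tower_top
  rw [adjoin.finrank hint,
    ← hω.minpoly_eq_cyclotomic_of_irreducible (cyclotomic.irreducible_rat hm), natDegree_cyclotomic]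

theorem totient_mul_natDegree_minpoly {p m : ℕ} (hp : 0 < p) (hm : 0 < m) {ω : L}
    (hω : IsPrimitiveRoot ω (p * m)) (k : ℕ) (hgen : ω ∈ ℚ⟮ω ^ p, ω ^ k⟯) :
    m.totient * (minpoly ℚ⟮ω ^ p⟯ (ω ^ k)).natDegree = (p * m).totient := by
  have hpm := Nat.mul_pos hp hm
  rw [← (hω.pow hpm rfl).finrank_rat_adjoin hm, ← hω.finrank_rat_adjoin hpm]
  exact finrank_adjoin_pow_mul_natDegree_minpoly (hω.isIntegral hpm).tower_top p k hgen

/-- The powers of a primitive root of order divisible by `p ^ 2` are independent over the field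
generated by its `p`-th power. -/
theorem IsPrimitiveRoot.eq_zero_of_sum_pow_mul_eq_zero {p m : ℕ} (hp : p.Prime) (hm : 0 < m)
    (hpm : p ∣ m) {ω : L} (hω : IsPrimitiveRoot ω (p * m)) (y : Fin p → L)
    (hy : ∀ j, y j ∈ ℚ⟮ω ^ p⟯) (h : ∑ j : Fin p, ω ^ (j : ℕ) * y j = 0) (j : Fin p) : y j = 0 := by
  -- As p ∣ m, φ(pm) = pφ(m), so ω has degree exactly p over ℚ(ω^p).
  have hd := totient_mul_natDegree_minpoly hp.pos hm hω 1 (subset_adjoin ℚ _ (by simp))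
  rw [pow_one, Nat.totient_mul_of_prime_of_dvd hp hpm, mul_comm] at hd
  have hd' := Nat.eq_of_mul_eq_mul_right (Nat.totient_pos.2 hm) hd
  have hli := linearIndependent_pow (K := ℚ⟮ω ^ p⟯) ω
  rw [hd', Fintype.linearIndependent_iff] at hli
  have := hli (fun j => ⟨y j, hy j⟩) (by
    simpa only [Algebra.smul_def, IntermediateField.algebraMap_apply, mul_comm] using h) j
  exact congrArg Subtype.val this

/-- A root of unity of prime order `p` satisfies only the obvious relation over the field
generated by a root of unity of order prime to `p`. -/
theorem IsPrimitiveRoot.eq_of_sum_pow_mul_eq_zero {p m : ℕ} (hp : p.Prime) (hm : 0 < m)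
    (hpm : p.Coprime m) {ω : L} (hω : IsPrimitiveRoot ω (p * m)) (y : Fin p → L)
    (hy : ∀ j, y j ∈ ℚ⟮ω ^ p⟯) (h : ∑ j : Fin p, (ω ^ m) ^ (j : ℕ) * y j = 0) (i j : Fin p) :
    y i = y j := by
  have hω0 : ω ≠ 0 := hω.ne_zero (Nat.mul_pos hp.pos hm).ne'
  have hgen : ω ∈ ℚ⟮ω ^ p, ω ^ m⟯ := by
    have h1 : ω = (ω ^ p) ^ (p.gcdA m) * (ω ^ m) ^ (p.gcdB m) := by
      rw [← zpow_natCast ω p, ← zpow_natCast ω m, ← zpow_mul, ← zpow_mul, ← zpow_add₀ hω0,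
        ← Nat.gcd_eq_gcd_ab, hpm.gcd_eq_one, Nat.cast_one, zpow_one]
    have h2 : (ω ^ p) ^ (p.gcdA m) * (ω ^ m) ^ (p.gcdB m) ∈ ℚ⟮ω ^ p, ω ^ m⟯ :=
      mul_mem (zpow_mem (subset_adjoin ℚ _ (by simp)) _) (zpow_mem (subset_adjoin ℚ _ (by simp)) _)
    rwa [← h1] at h2
  have hd := totient_mul_natDegree_minpoly hp.pos hm hω m hgen
  rw [Nat.totient_mul hpm, Nat.totient_prime hp, mul_comm] at hd
  have hd' := Nat.eq_of_mul_eq_mul_right (Nat.totient_pos.2 hm) hd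
  have hρ := (hω.pow (Nat.mul_pos hp.pos hm) (mul_comm p m)).sum_pow_fin_eq_zero hp
  have hli := linearIndependent_pow (K := ℚ⟮ω ^ p⟯) (ω ^ m)
  obtain ⟨k, rfl⟩ : ∃ k, p = k + 1 := ⟨p - 1, by have := hp.pos; omega⟩
  rw [hd', Nat.add_sub_cancel, Fintype.linearIndependent_iff] at hli
  -- The degree is now only p - 1 = k, so the last power is removed by subtracting a multiple of ∑
  -- ρ^j = 0.
  have hsub : ∑ j : Fin (k + 1), (ω ^ m) ^ (j : ℕ) * (y j - y (Fin.last k)) = 0 := by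
    simp only [mul_sub, Finset.sum_sub_distrib, ← Finset.sum_mul, h, hρ, zero_mul, sub_zero]
  rw [Fin.sum_univ_castSucc, sub_self, mul_zero, add_zero] at hsub
  have hz := hli (fun j => ⟨y j.castSucc - y (Fin.last k), sub_mem (hy _) (hy _)⟩) (by
    simpa only [Algebra.smul_def, IntermediateField.algebraMap_apply, mul_comm,
      Fin.val_castSucc] using hsub)
  have hlast : ∀ j, y j = y (Fin.last k) := by
    intro j
    induction j using Fin.lastCases with
    | last => rfl
    | cast j => exact sub_eq_zero.1 (congrArg Subtype.val (hz j))
  rw [hlast i, hlast j]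

/-! ### Squarefree order and the dimension bound -/

variable {ι : Type*} {η : ι → L}

theorem squarefree_of_spanConnected {m : ℕ} (hm : 0 < m) {ω : L} (hω : IsPrimitiveRoot ω m)
    (hconn : SpanConnected η) {i₀ : ι} (hi₀ : η i₀ = 1)
    (hord : ∀ d : ℕ, (∀ i, η i ^ d = 1) ↔ m ∣ d) : Squarefree m := by
  rw [Nat.squarefree_iff_prime_squarefree]
  rintro p hp ⟨k, rfl⟩
  rw [mul_assoc] at hm hord hω
  have hk : 0 < p * k := Nat.pos_of_mul_pos_left hm
  have : NeZero (p * (p * k)) := ⟨hm.ne'⟩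
  have : NeZero p := ⟨hp.ne_zero⟩
  have hpow : ∀ i, ∃ f : ℕ, ω ^ f = η i := fun i =>
    let ⟨f, _, hf⟩ := hω.eq_pow_of_pow_eq_one ((hord _).2 dvd_rfl i)
    ⟨f, hf⟩
  choose f hf using hpow
  let e : ι → Fin p := fun i => Fin.ofNat p (f i)
  let θ : ι → L := fun i => (ω ^ p) ^ (f i / p)
  have hη : η = fun i => ω ^ (e i : ℕ) * θ i := by
    ext i
    simp only [e, θ, Fin.val_ofNat, ← pow_mul, ← pow_add, Nat.mod_add_div, hf]
  have hθ : ∀ S : Set ι, ∀ x ∈ Submodule.span ℚ (θ '' S), x ∈ ℚ⟮ω ^ p⟯ := fun S x hx => by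
    have : Submodule.span ℚ (θ '' S) ≤ Subalgebra.toSubmodule ℚ⟮ω ^ p⟯.toSubalgebra :=
      Submodule.span_le.2 (by
        rintro _ ⟨i, -, rfl⟩
        exact pow_mem (mem_adjoin_simple_self ℚ (ω ^ p)) _)
    exact this hx
  have he₀ : e i₀ = 0 := by
    have h1 : p * (p * k) ∣ f i₀ := (hω.pow_eq_one_iff_dvd _).1 ((hf i₀).trans hi₀)
    ext
    simpa [e] using Nat.mod_eq_zero_of_dvd ((Dvd.intro _ rfl).trans h1)
  -- Otherwise the classes e = 0 and e ≠ 0 split the family, and independence of the powers of ω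
  -- makes their spans meet only in 0.
  have hall : ∀ i, e i = 0 := by
    by_contra! hne
    obtain ⟨i₁, hi₁⟩ := hne
    rw [hη] at hconn
    obtain ⟨x, hx0, hx, hx'⟩ := hconn (e ⁻¹' {0}) ⟨i₀, he₀⟩ ⟨i₁, hi₁⟩
    obtain ⟨y, hy, rfl⟩ := exists_graded_of_mem_span ω e θ _ hx
    obtain ⟨z, hz, hyz⟩ := exists_graded_of_mem_span ω e θ _ hx'
    have hd := hω.eq_zero_of_sum_pow_mul_eq_zero hp hk (Dvd.intro _ rfl) (fun j => y j - z j)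
      (fun j => sub_mem (hθ _ _ (hy j)) (hθ _ _ (hz j)))
      (by simp only [mul_sub, Finset.sum_sub_distrib, hyz, sub_self])
    refine hx0 (Finset.sum_eq_zero fun j _ => ?_)
    have : y j = 0 := by
      by_cases hj : j = 0
      · subst hj
        have hz0 : z 0 = 0 := by simpa using hz 0
        have := hd 0
        rwa [hz0, sub_zero] at this
      · have h := hy j
        rwa [← Set.preimage_inter, Set.singleton_inter_eq_empty.2 (by simpa using Ne.symm hj),
          Set.preimage_empty, Set.image_empty, Submodule.span_empty, Submodule.mem_bot] at h
    rw [this, mul_zero]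
  have hdvd : p * (p * k) ∣ p * k := (hord _).1 fun i => by
    have h0 : f i % p = 0 := by simpa [e] using congrArg Fin.val (hall i)
    obtain ⟨c, hc⟩ := Nat.dvd_of_mod_eq_zero h0
    rw [← hf i, ← pow_mul, hω.pow_eq_one_iff_dvd, hc]
    exact ⟨c, by ring⟩
  have := Nat.le_of_dvd hk hdvd
  nlinarith [hp.two_le]

theorem one_add_sum_le_finrank_of_spanConnected [Finite ι] (m : ℕ) (hsq : Squarefree m)
    {ω : L} (hω : IsPrimitiveRoot ω m) (hconn : SpanConnected η) {i₀ : ι} (hi₀ : η i₀ = 1)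
    (hord : ∀ d : ℕ, (∀ i, η i ^ d = 1) ↔ m ∣ d) :
    1 + ∑ p ∈ m.primeFactors, ((p : ℤ) - 2) ≤ finrank ℚ (Submodule.span ℚ (Set.range η)) := by
  induction m using Nat.strong_induction_on generalizing ω η with
  | _ n ih =>
  have hfin : FiniteDimensional ℚ (Submodule.span ℚ (Set.range η)) :=
    FiniteDimensional.span_of_finite ℚ (Set.finite_range _)
  by_cases hn : n = 1
  · subst hn
    have : Nontrivial (Submodule.span ℚ (Set.range η)) :=
      ⟨⟨⟨1, Submodule.subset_span ⟨i₀, hi₀⟩⟩, 0, fun h => one_ne_zero (congrArg Subtype.val h)⟩⟩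
    have := finrank_pos (R := ℚ) (M := Submodule.span ℚ (Set.range η))
    simp only [Nat.primeFactors_one, Finset.sum_empty]
    omega
  obtain ⟨p, hp, m, rfl⟩ := Nat.exists_prime_and_dvd hn
  have hpm : p.Coprime m := Nat.coprime_of_squarefree_mul hsq
  have hm : 0 < m := Nat.pos_of_ne_zero fun h => hsq.ne_zero (by simp [h])
  have hm' : 0 < p * m := Nat.mul_pos hp.pos hm
  have : NeZero (p * m) := ⟨hm'.ne'⟩
  have : NeZero m := ⟨hm.ne'⟩
  have : NeZero p := ⟨hp.ne_zero⟩
  have hρ : IsPrimitiveRoot (ω ^ m) p := hω.pow hm' (mul_comm p m)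
  have hωp : IsPrimitiveRoot (ω ^ p) m := hω.pow hm' rfl
  -- Exponents projecting a root of unity of order dividing p * m to its components: η^u has order
  -- dividing m, η^v has order dividing p, and u + v ≡ 1 gives η = η^v η^u.
  obtain ⟨u, hup, hum⟩ := Nat.chineseRemainder hpm 0 1
  obtain ⟨v, hvp, hvm⟩ := Nat.chineseRemainder hpm 1 0
  have hpu : p ∣ u := Nat.dvd_of_mod_eq_zero hup
  have hmv : m ∣ v := Nat.dvd_of_mod_eq_zero hvm
  have huv : u + v ≡ 1 [MOD p * m] :=
    (Nat.modEq_and_modEq_iff_modEq_mul hpm).1 ⟨hup.add hvp, hum.add hvm⟩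
  have hηm : ∀ i, η i ^ (p * m) = 1 := (hord _).2 dvd_rfl
  have hpow : ∀ i, ∃ f < p, (ω ^ m) ^ f = η i ^ v := fun i =>
    hρ.eq_pow_of_pow_eq_one (by
      obtain ⟨c, hc⟩ := hmv
      rw [← pow_mul, hc, show m * c * p = p * m * c by ring, pow_mul, hηm, one_pow])
  choose f hfp hf using hpow
  let e : ι → Fin p := fun i => ⟨f i, hfp i⟩
  let θ : ι → L := fun i => η i ^ u
  have hη : η = fun i => (ω ^ m) ^ (e i : ℕ) * θ i := by
    ext i
    simp only [e, θ, hf, ← pow_add]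
    rw [add_comm, pow_eq_pow_mod _ (hηm i), huv, ← pow_eq_pow_mod _ (hηm i), pow_one]
  have hθm : ∀ i, θ i ^ m = 1 := fun i => by
    obtain ⟨c, hc⟩ := hpu
    simp only [θ]
    rw [← pow_mul, hc, show p * c * m = p * m * c by ring, pow_mul, hηm, one_pow]
  have hθ : ∀ i, θ i ∈ Subalgebra.toSubmodule ℚ⟮ω ^ p⟯.toSubalgebra := fun i => by
    obtain ⟨c, -, hc⟩ := hωp.eq_pow_of_pow_eq_one (hθm i)
    rw [← hc]
    exact pow_mem (mem_adjoin_simple_self ℚ (ω ^ p)) c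
  have hind := hω.eq_of_sum_pow_mul_eq_zero hp hm hpm
  have he₀ : f i₀ = 0 := by
    refine hρ.pow_inj (hfp i₀) hp.pos ?_
    rw [hf, hi₀, one_pow, pow_zero]
  -- A constant `e` would be 0, its value at `i₀`; then every `η i` would have order dividing m
  -- instead of p * m.
  have hne : ∃ i j, e i ≠ e j := by
    by_contra! hall
    have : p * m ∣ m := (hord m).1 fun i => by
      have hfi : f i = 0 := (congrArg Fin.val (hall i i₀)).trans he₀
      rw [hη]
      simp only [e, hfi, pow_zero, one_mul, hθm]
    have := Nat.le_of_dvd hm this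
    nlinarith [hp.two_le]
  have hordθ : ∀ d : ℕ, (∀ i, θ i ^ d = 1) ↔ m ∣ d := fun d => by
    simp only [θ, ← pow_mul]
    rw [hord]
    constructor
    · intro h
      have hcop : m.Coprime u := by
        rw [Nat.coprime_comm, Nat.Coprime, hum.gcd_eq, Nat.gcd_one_left]
      exact hcop.dvd_of_dvd_mul_left ((Dvd.intro_left p rfl).trans h)
    · exact fun h => mul_dvd_mul hpu h
  rw [hη] at hconn
  have hconnθ := hconn.of_graded (hρ.sum_pow_fin_eq_zero hp) hind hθ hp.pos
  have hle := hconn.finrank_add_le_of_graded hp.two_le hind hθ hne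
  rw [← hη] at hle
  have hrec := ih m (lt_mul_of_one_lt_left hm hp.one_lt) (hsq.squarefree_of_dvd (Dvd.intro_left p rfl))
    hωp hconnθ (by simp only [θ, hi₀, one_pow]) hordθ
  have hnot : p ∉ m.primeFactors := fun h =>
    (Nat.Prime.coprime_iff_not_dvd hp).1 hpm (Nat.dvd_of_mem_primeFactors h)
  rw [hpm.primeFactors_mul, hp.primeFactors, Finset.sum_union (by simpa using hnot), Finset.sum_singleton]
  omega

end Cyclotomic

/-! ### From the Laurent polynomial to a span-connected family -/

section Main

theorem MvLaurent.eval_sum_single {n : ℕ} {ι : Type*} [Fintype ι] (z : Fin n → QBarˣ) (a : ι → ℤ)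
    (α : ι → Fin n → ℤ) :
    MvLaurent.eval z (∑ i, AddMonoidAlgebra.single (α i) (a i)) =
      ∑ i, (a i : QBar) * torusMonomial z (α i) := by
  classical
  rw [MvLaurent.eval, AddMonoidAlgebra.coeff_sum,
    ← Finsupp.sum_finsetSum_index (by simp) (by intros; push_cast; ring)]
  refine Finset.sum_congr rfl fun i _ => ?_
  rw [AddMonoidAlgebra.coeff_single]
  exact Finsupp.sum_single_index (by simp)

section Relation
variable {ι L : Type*} [Field L] [Algebra ℚ L] [Fintype ι] {a : ι → ℚ} {η : ι → L}

theorem spanConnected_of_sum_ne_zero (hzero : ∑ i, a i • η i = 0)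
    (hmin : ∀ J : Finset ι, J.Nonempty → J ≠ Finset.univ → ∑ i ∈ J, a i • η i ≠ 0) :
    SpanConnected η := by
  classical
  intro J hJ hJ'
  have hsum : ∀ S : Set ι, ∑ i ∈ S.toFinset, a i • η i ∈ Submodule.span ℚ (η '' S) := fun S =>
    Submodule.sum_mem _ fun i hi => Submodule.smul_mem _ _
      (Submodule.subset_span ⟨i, Set.mem_toFinset.1 hi, rfl⟩)
  refine ⟨∑ i ∈ J.toFinset, a i • η i, hmin _ (Set.toFinset_nonempty.2 hJ) ?_, hsum J, ?_⟩
  · obtain ⟨i, hi⟩ := hJ'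
    exact fun h => hi (Set.mem_toFinset.1 (h ▸ Finset.mem_univ i))
  · have h := Finset.sum_add_sum_compl J.toFinset fun i => a i • η i
    rw [hzero, ← Set.toFinset_compl] at h
    rw [eq_neg_of_add_eq_zero_left h]
    convert neg_mem (hsum Jᶜ)

theorem finrank_span_lt_card_of_sum_eq_zero (hzero : ∑ i, a i • η i = 0) {i : ι} (hi : a i ≠ 0) :
    finrank ℚ (Submodule.span ℚ (Set.range η)) < Fintype.card ι := by
  refine lt_of_le_of_ne (finrank_range_le_card η) fun h => hi ?_
  exact Fintype.linearIndependent_iff.1 (linearIndependent_iff_card_eq_finrank_span.2 h.symm)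
    a hzero i

end Relation

theorem orderOf_pos_of_torsion {ι G : Type*} [Fintype ι] [CommGroup G]
    (ζ : ι → CommGroup.torsion G) : 0 < orderOf ζ := by
  refine orderOf_pos_iff.2 (isOfFinOrder_iff_pow_eq_one.2
    ⟨∏ i, orderOf (ζ i), Finset.prod_pos fun i _ => ?_, ?_⟩)
  · exact (Submonoid.isOfFinOrder_coe.1 (ζ i).2).orderOf_pos
  · ext1 i
    exact orderOf_dvd_iff_pow_eq_one.1 (Finset.dvd_prod_of_mem _ (Finset.mem_univ i))

theorem torusMonomial_sub {n : ℕ} (z : Fin n → QBarˣ) (l l' : Fin n → ℤ) :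
    torusMonomial z (l - l') = torusMonomial z l * (torusMonomial z l')⁻¹ := by
  simp only [torusMonomial, Pi.sub_apply, zpow_sub, Finset.prod_mul_distrib, Finset.prod_inv_distrib,
    Units.val_mul, Units.val_inv_eq_inv_val]

theorem torusMonomial_ne_zero {n : ℕ} (z : Fin n → QBarˣ) (l : Fin n → ℤ) :
    torusMonomial z l ≠ 0 := Units.ne_zero _

theorem torusMonomial_zero {n : ℕ} (z : Fin n → QBarˣ) : torusMonomial z 0 = 1 := by
  simp [torusMonomial]

theorem torusMonomial_single_one {n : ℕ} (z : Fin n → QBarˣ) (j : Fin n) :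
    torusMonomial z (Pi.single j 1) = z j := by
  rw [torusMonomial, Finset.prod_eq_single j (fun b _ hb => by simp [hb]) (by simp)]
  simp

/-- The exponents whose monomial has trivial d-th power at ζ form a subgroup; if it contains
generators of ℤⁿ, it contains the coordinate vectors. -/
theorem forall_torusMonomial_pow_eq_one_iff {n : ℕ} (ζ : Fin n → MuInf) {s : Set (Fin n → ℤ)}
    (hs : AddSubgroup.closure s = ⊤) (d : ℕ) :
    (∀ l ∈ s, torusMonomial (fun j => (ζ j : QBarˣ)) l ^ d = 1) ↔ orderOf ζ ∣ d := by
  rw [orderOf_dvd_iff_pow_eq_one]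
  constructor
  · intro h
    have hall : ∀ l, torusMonomial (fun j => (ζ j : QBarˣ)) l ^ d = 1 := fun l => by
      have hl : l ∈ AddSubgroup.closure s := hs ▸ AddSubgroup.mem_top l
      induction hl using AddSubgroup.closure_induction with
      | mem l hl => exact h l hl
      | zero => rw [torusMonomial_zero, one_pow]
      | add l l' _ _ hl hl' =>
        rw [← sub_neg_eq_add, torusMonomial_sub, ← zero_sub, torusMonomial_sub, torusMonomial_zero,
          one_mul, inv_inv, mul_pow, hl, hl', one_mul]
      | neg l _ hl =>
        rw [← zero_sub, torusMonomial_sub, torusMonomial_zero, one_mul, inv_pow, hl, inv_one]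
    ext j
    have := hall (Pi.single j 1)
    rw [torusMonomial_single_one] at this
    simpa using this
  · intro h l _
    rw [torusMonomial, ← Units.val_pow_eq_pow_val, Units.val_eq_one, ← Finset.prod_pow]
    refine Finset.prod_eq_one fun j _ => ?_
    have hj : (ζ j : QBarˣ) ^ d = 1 := congrArg Subtype.val (congrFun h j)
    rw [← zpow_natCast, zpow_comm, zpow_natCast, hj, one_zpow]

end Main

theorem mainTheorem5 (n : ℕ) (hn : 1 ≤ n)
    (ζ : Fin n → MuInf) (m : ℕ) (hm : orderOf ζ = m)
    (N : ℕ) (a : Fin N → ℤ) (α : Fin N → Fin n → ℤ)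
    (F : MvLaurent n) (hF : F = ∑ i, AddMonoidAlgebra.single (α i) (a i))
    (hzero : MvLaurent.eval (fun j => (ζ j : QBarˣ)) F = 0)
    (hmin : NoProperSubsumVanishes
      fun i : Fin N => (a i : QBar) * torusMonomial (fun j => (ζ j : QBarˣ)) (α i))
    (hgen : AddSubgroup.closure
      {β : Fin n → ℤ | ∃ i j : Fin N, β = α i - α j} = ⊤) :
    Squarefree m ∧ conwayJonesPsi m ≤ (N : ℤ) := by
  rw [hF, MvLaurent.eval_sum_single] at hzero
  have hmpos : 0 < m := hm ▸ orderOf_pos_of_torsion ζ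
  -- With at most one term all differences vanish and cannot generate ℤⁿ, as n ≥ 1. The second index
  -- makes {i₀} a proper subset, so that minimality gives `a i₀ ≠ 0`.
  obtain ⟨i₀, i₁, h01⟩ : ∃ i j : Fin N, i ≠ j := by
    by_contra! h
    have hbot : AddSubgroup.closure {β : Fin n → ℤ | ∃ i j : Fin N, β = α i - α j} = ⊥ := by
      rw [AddSubgroup.closure_eq_bot_iff]
      rintro _ ⟨i, j, rfl⟩
      simp [h i j]
    have hmem : (1 : Fin n → ℤ) ∈ (⊥ : AddSubgroup (Fin n → ℤ)) := by
      rw [← hbot, hgen]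
      exact AddSubgroup.mem_top _
    exact one_ne_zero (congrFun (AddSubgroup.mem_bot.1 hmem) ⟨0, hn⟩)
  set z : Fin n → QBarˣ := fun j => (ζ j : QBarˣ) with hz
  set η : Fin N → QBar := fun i => torusMonomial z (α i - α i₀) with hη
  have hsmul : ∀ i, (a i : ℚ) • η i =
      (a i : QBar) * torusMonomial z (α i) * (torusMonomial z (α i₀))⁻¹ := fun i => by
    simp only [hη, Algebra.smul_def, map_intCast, torusMonomial_sub, mul_assoc]
  have hinv := inv_ne_zero (torusMonomial_ne_zero z (α i₀))
  have hzero' : ∑ i, (a i : ℚ) • η i = 0 := by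
    simp_rw [hsmul, ← Finset.sum_mul, hzero, zero_mul]
  have hconn : SpanConnected η := spanConnected_of_sum_ne_zero hzero' fun J hJ hJ' => by
    simp_rw [hsmul, ← Finset.sum_mul]
    exact mul_ne_zero (hmin J hJ hJ') hinv
  have ha : (a i₀ : ℚ) ≠ 0 := fun h => by
    refine hmin {i₀} (Finset.singleton_nonempty i₀) (fun h' => h01 ?_) ?_
    · exact (Finset.mem_singleton.1 (h' ▸ Finset.mem_univ i₁)).symm
    · simp [Int.cast_eq_zero.1 h]
  have hlt := finrank_span_lt_card_of_sum_eq_zero hzero' ha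
  have hone : η i₀ = 1 := by rw [hη]; simp only [sub_self, torusMonomial_zero]
  have hord : ∀ d : ℕ, (∀ i, η i ^ d = 1) ↔ m ∣ d := fun d => by
    rw [← hm, ← forall_torusMonomial_pow_eq_one_iff ζ hgen]
    refine ⟨?_, fun h i => h _ ⟨i, i₀, rfl⟩⟩
    rintro h _ ⟨i, j, rfl⟩
    rw [← sub_sub_sub_cancel_right (α i) (α j) (α i₀), torusMonomial_sub, mul_pow, inv_pow]
    exact (congrArg₂ (fun x y => x * y⁻¹) (h i) (h j)).trans (by simp)
  have : NeZero (m : QBar) := ⟨by exact_mod_cast hmpos.ne'⟩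
  obtain ⟨ω, hω⟩ := HasEnoughRootsOfUnity.exists_primitiveRoot QBar m
  have hsq := squarefree_of_spanConnected hmpos hω hconn hone hord
  refine ⟨hsq, ?_⟩
  have hle := one_add_sum_le_finrank_of_spanConnected m hsq hω hconn hone hord
  rw [Fintype.card_fin] at hlt
  rw [conwayJonesPsi]
  omega
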